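/- Let $R$ be an integral domain with quotient field $K$. For a nonzero fractional ideal $I$ of $R$ put $I^{-1}=\{x\in K: xI\subseteq R\}$, $I_v=(I^{-1})^{-1}$ and $I_t=\bigcup J_v$, where $J$ ranges over the nonzero finitely generated fractional ideals contained in $I$. Call $I$ a $t$-ideal if $I_t=I$, and $t$-invertible if $(II^{-1})_t=R$. The domain $R$ is a PVMD if every nonzero finitely generated ideal of $R$ is $t$-invertible. An overring $T$ of $R$ (a ring with $R\subseteq T\subseteq K$) is $t$-linked over $R$ if $\{x\in K: xIT\subseteq T\}=T$ for every nonzero finitely generated ideal $I$ of $R$ with $I^{-1}=R$. For an ideal $I$ of $R$ the Kaplansky transform is $\Omega(I)=\{u\in K:\text{for every }a\in I\text{ there is an integer }n\ge 1\text{ with }ua^{n}\in R\}$. **Theorem.** Let $R$ be a PVMD and let $P$ be a nonzero prime ideal of $R$ that is a $t$-ideal and is not $t$-invertible. Then there is no $t$-linked overring $T$ of $R$ with $P^{-1}\subsetneq T\subsetneq\Omega(P)$. -/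

import Mathlib

/-!
Star operations and overrings of an integral domain `R` with quotient field `K`.
Fractional ideals are handled as `R`-submodules of `K`; an overring of `R` is a
`Subalgebra R K`, that is, a ring `T` with `R ⊆ T ⊆ K`.
-/

namespace PVMD

variable {R : Type*} [CommRing R] {K : Type*} [Field K] [Algebra R K]

/-- The dual `I⁻¹ = (R : I) = {x ∈ K | x I ⊆ R}`. -/
noncomputable def dual (I : Submodule R K) : Submodule R K := 1 / I

theorem mem_dual {I : Submodule R K} {x : K} :
    x ∈ dual I ↔ ∀ y ∈ I, ∃ r : R, algebraMap R K r = x * y := by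
  simp only [dual, Submodule.mem_div_iff_forall_mul_mem, Submodule.mem_one]

/-- The `v`-closure `I_v = (I⁻¹)⁻¹`. -/
noncomputable def vClosure (I : Submodule R K) : Submodule R K := dual (dual I)

/-- The `t`-closure `I_t`: the union of the `J_v`, where `J` ranges over the nonzero finitely
generated fractional ideals contained in `I`. -/
def tClosure (I : Submodule R K) : Set K :=
  {x | ∃ J : Submodule R K, J ≠ ⊥ ∧ J.FG ∧ J ≤ I ∧ x ∈ vClosure J}

/-- `I` is a `t`-ideal if `I_t = I`. -/
def IsTIdeal (I : Submodule R K) : Prop := tClosure I = (I : Set K)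

/-- `I` is `t`-invertible if `(I I⁻¹)_t = R`. -/
def IsTInvertible (I : Submodule R K) : Prop :=
  tClosure (I * dual I) = ((1 : Submodule R K) : Set K)

variable (R K) in
/-- `R` (with quotient field `K`) is a Prüfer `v`-multiplication domain: every nonzero finitely
generated ideal is `t`-invertible. -/
def IsPVMD : Prop :=
  ∀ I : Ideal R, I ≠ ⊥ → I.FG → IsTInvertible (IsLocalization.coeSubmodule K I)

variable (K) in
/-- The Kaplansky transform: all `u ∈ K` such that for every `a ∈ I` there is a positive integer
`n` (depending on `a`) with `u a ^ n ∈ R`. It is an overring of `R`. -/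
def kaplanskyTransform (I : Ideal R) : Subalgebra R K where
  carrier := {u | ∀ a ∈ I, ∃ n : ℕ, 0 < n ∧ ∃ r : R, algebraMap R K r = u * algebraMap R K a ^ n}
  mul_mem' := by
    intro u v hu hv a ha
    obtain ⟨n, hn, r, hr⟩ := hu a ha
    obtain ⟨m, hm, s, hs⟩ := hv a ha
    refine ⟨n + m, by omega, r * s, ?_⟩
    rw [map_mul, hr, hs]
    ring
  add_mem' := by
    intro u v hu hv a ha
    obtain ⟨n, hn, r, hr⟩ := hu a ha
    obtain ⟨m, hm, s, hs⟩ := hv a ha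
    refine ⟨n + m, by omega, r * a ^ m + s * a ^ n, ?_⟩
    simp only [map_add, map_mul, map_pow, hr, hs]
    ring
  algebraMap_mem' := by
    intro c a _
    exact ⟨1, one_pos, c * a, by simp⟩

/-- An overring `T` is `t`-linked over `R` if for every (nonzero) finitely generated ideal `I` of
`R` with `I⁻¹ = R` one has `(T : IT) = T`. -/
def IsTLinked (T : Subalgebra R K) : Prop :=
  ∀ I : Ideal R, I ≠ ⊥ → I.FG → dual (IsLocalization.coeSubmodule K I) = 1 →
    Subalgebra.toSubmodule T / (IsLocalization.coeSubmodule K I * Subalgebra.toSubmodule T) =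
      Subalgebra.toSubmodule T

end PVMD

namespace PVMD

variable {R : Type*} [CommRing R] {K : Type*} [Field K] [Algebra R K]

/-! Compare `T` with the localization `R_P`. If `T ⊆ R_P`, then `T ⊆ Ω(P) ∩ R_P ⊆ P⁻¹`; otherwise
some `x ∈ T` outside `R_P` forces `Ω(P) ⊆ T`. Both halves apply `IsPVMD.exists_fg_le_dual_eq_one`:
for a suitable two-generated ideal `A`, membership in `Ω(P)` puts `A A⁻¹` in the radical of a
conductor, so the conductor contains a finitely generated `I` with `I⁻¹ = R`. Such an `I` can be
cancelled over `R`, and over `T` by `t`-linkedness. -/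

theorem mem_dual_coeSubmodule {I : Ideal R} {x : K} :
    x ∈ dual (IsLocalization.coeSubmodule K I) ↔
      ∀ a ∈ I, ∃ r : R, algebraMap R K r = x * algebraMap R K a := by
  rw [mem_dual]
  constructor
  · exact fun h a ha => h _ ((IsLocalization.mem_coeSubmodule K I).2 ⟨a, ha, rfl⟩)
  · rintro h y hy
    obtain ⟨a, ha, rfl⟩ := (IsLocalization.mem_coeSubmodule K I).1 hy
    exact h a ha

theorem dual_coeSubmodule_eq_one_iff {I : Ideal R} :
    dual (IsLocalization.coeSubmodule K I) = 1 ↔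
      ∀ x : K, (∀ a ∈ I, ∃ r : R, algebraMap R K r = x * algebraMap R K a) →
        ∃ r : R, algebraMap R K r = x := by
  constructor
  · intro h x hx
    rw [← mem_dual_coeSubmodule, h, Submodule.mem_one] at hx
    exact hx
  · intro h
    ext x
    rw [mem_dual_coeSubmodule, Submodule.mem_one]
    refine ⟨h x, ?_⟩
    rintro ⟨r, rfl⟩ a _
    exact ⟨r * a, map_mul _ _ _⟩

/-- If `x Iⁿ⁺¹ ⊆ R` and `a ∈ Iⁿ`, then `(x a) I ⊆ R`, so `x a ∈ R`; induction removes the rest. -/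
theorem dual_coeSubmodule_pow_eq_one {I : Ideal R}
    (h : dual (IsLocalization.coeSubmodule K I) = 1) (n : ℕ) :
    dual (IsLocalization.coeSubmodule K (I ^ n)) = 1 := by
  rw [dual_coeSubmodule_eq_one_iff] at h ⊢
  induction n with
  | zero => intro x hx; simpa using hx 1 (by simp)
  | succ n ih =>
    intro x hx
    refine ih x fun a ha => h _ fun b hb => ?_
    obtain ⟨r, hr⟩ := hx (a * b) (by rw [pow_succ]; exact Ideal.mul_mem_mul ha hb)
    exact ⟨r, by rw [hr, map_mul, mul_assoc]⟩

/-- In a PVMD, an ideal whose radical contains `(a, b)(a, b)⁻¹` contains a finitely generated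
ideal with trivial dual. -/
theorem IsPVMD.exists_fg_le_dual_eq_one [IsDomain R] [IsFractionRing R K] (hR : IsPVMD R K)
    {a b : R} (ha : a ≠ 0) (C : Ideal R)
    (hC : ∀ (h : K) (r s : R), algebraMap R K r = h * algebraMap R K a →
      algebraMap R K s = h * algebraMap R K b → r ∈ C.radical ∧ s ∈ C.radical) :
    ∃ I : Ideal R, I ≠ ⊥ ∧ I.FG ∧ I ≤ C ∧ dual (IsLocalization.coeSubmodule K I) = 1 := by
  set A : Ideal R := Ideal.span {a, b} with hA
  have haA : a ∈ A := Ideal.subset_span (by simp)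
  have hbA : b ∈ A := Ideal.subset_span (by simp)
  have hA0 : A ≠ ⊥ := fun h => ha (by simpa [h] using haA)
  have hinv : tClosure _ = _ := hR A hA0 (Submodule.fg_span (Set.toFinite _))
  have h1 : (1 : K) ∈ tClosure (IsLocalization.coeSubmodule K A *
      dual (IsLocalization.coeSubmodule K A)) := by
    rw [hinv]; exact Submodule.mem_one.2 ⟨1, map_one _⟩
  obtain ⟨J, hJ0, hJfg, hJle, hJ⟩ := h1
  have hle : IsLocalization.coeSubmodule K A * dual (IsLocalization.coeSubmodule K A) ≤
      IsLocalization.coeSubmodule K C.radical := by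
    rw [Submodule.mul_le]
    intro y hy h hh
    obtain ⟨c, hc, rfl⟩ := (IsLocalization.mem_coeSubmodule K A).1 hy
    rw [mem_dual_coeSubmodule] at hh
    obtain ⟨r, hr⟩ := hh a haA
    obtain ⟨s, hs⟩ := hh b hbA
    obtain ⟨hrC, hsC⟩ := hC h r s hr hs
    obtain ⟨α, β, rfl⟩ := Ideal.mem_span_pair.1 hc
    refine (IsLocalization.mem_coeSubmodule K _).2 ⟨α * r + β * s,
      add_mem (Ideal.mul_mem_left _ _ hrC) (Ideal.mul_mem_left _ _ hsC), ?_⟩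
    simp only [map_add, map_mul, hr, hs]
    ring
  have hinj : Function.Injective (Algebra.linearMap R K) := IsFractionRing.injective R K
  obtain ⟨B, rfl⟩ : ∃ B : Ideal R, IsLocalization.coeSubmodule K B = J := by
    refine ⟨J.comap (Algebra.linearMap R K), Submodule.map_comap_eq_of_le ?_⟩
    exact (hJle.trans hle).trans LinearMap.map_le_range
  have hBfg : B.FG := Submodule.fg_of_fg_map_injective _ hinj hJfg
  have hB0 : B ≠ ⊥ := by
    rintro rfl
    exact hJ0 (Submodule.map_bot _)
  have hBC : B ≤ C.radical := (Submodule.map_le_map_iff_of_injective hinj _ _).1 (hJle.trans hle)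
  have hBd : dual (IsLocalization.coeSubmodule K B) = 1 := by
    rw [dual_coeSubmodule_eq_one_iff]
    -- Since `1 ∈ B_v`, multiplying `x ∈ B⁻¹` by `1` lands in `R`.
    intro x hx
    simpa using mem_dual.1 hJ x (mem_dual_coeSubmodule.2 hx)
  -- Finite generation of `B` gives one exponent valid for the whole ideal.
  obtain ⟨n, hn⟩ := Ideal.exists_pow_le_of_le_radical_of_fg hBC hBfg
  exact ⟨B ^ n, pow_ne_zero n hB0, hBfg.pow, hn, dual_coeSubmodule_pow_eq_one hBd n⟩

/-- The ideal `{r ∈ R | r u ∈ M}`. -/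
noncomputable def conductor (M : Submodule R K) (u : K) : Ideal R :=
  M.comap (LinearMap.toSpanSingleton R K u)

theorem mem_conductor {M : Submodule R K} {u : K} {r : R} :
    r ∈ conductor M u ↔ algebraMap R K r * u ∈ M := by
  simp [conductor, Algebra.smul_def]

theorem IsTLinked.mem_of_le_conductor {T : Subalgebra R K} (hT : IsTLinked T) {I : Ideal R}
    (hI0 : I ≠ ⊥) (hI : I.FG) (hId : dual (IsLocalization.coeSubmodule K I) = 1) {u : K}
    (hu : I ≤ conductor (Subalgebra.toSubmodule T) u) : u ∈ T := by
  rw [← Subalgebra.mem_toSubmodule, ← hT I hI0 hI hId, Submodule.mem_div_iff_forall_mul_mem]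
  intro y hy
  refine Submodule.mul_induction_on hy ?_ ?_
  · intro x hx t ht
    obtain ⟨r, hr, rfl⟩ := (IsLocalization.mem_coeSubmodule K I).1 hx
    have := T.mul_mem (mem_conductor.1 (hu hr)) ht
    rwa [mul_comm _ u, mul_assoc] at this
  · intro x y hx hy
    rw [mul_add]
    exact add_mem hx hy

/-- The elements of the Kaplansky transform of a prime `P` that lie in the localization at `P`
belong to `P⁻¹`. -/
theorem IsPVMD.mem_dual_of_mem_kaplanskyTransform [IsDomain R] [IsFractionRing R K]
    (hR : IsPVMD R K) {P : Ideal R} (hP : P.IsPrime) {u : K} (hu : u ∈ kaplanskyTransform K P)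
    {s : R} (hs : s ∉ P) (hsu : ∃ r : R, algebraMap R K r = algebraMap R K s * u) :
    u ∈ dual (IsLocalization.coeSubmodule K P) := by
  rw [mem_dual_coeSubmodule]
  intro a ha
  have hs0 : s ≠ 0 := fun h => hs (h ▸ P.zero_mem)
  obtain ⟨q, hq⟩ := hsu
  -- Take `A = (s, a)`. For `h ∈ A⁻¹`, `hs` carries `u a` to `q (h a) ∈ R`, while `s (h a) = (h s) a
  -- ∈ P` puts `h a` in `P`, where `Ω(P)` supplies a power.
  obtain ⟨I, -, -, hIC, hId⟩ := hR.exists_fg_le_dual_eq_one hs0 (b := a)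
    (conductor (1 : Submodule R K) (u * algebraMap R K a)) (by
      intro h r c hr hc
      refine ⟨Ideal.le_radical (mem_conductor.2 (Submodule.mem_one.2 ⟨q * c, ?_⟩)), ?_⟩
      · rw [map_mul, hq, hc, hr]
        ring
      · have hcP : c ∈ P := by
          refine (hP.mem_or_mem (x := s) ?_).resolve_left hs
          have : s * c = r * a := by
            apply IsFractionRing.injective R K
            rw [map_mul, map_mul, hc, hr]
            ring
          exact this ▸ P.mul_mem_left r ha
        obtain ⟨n, -, d, hd⟩ := hu c hcP
        refine ⟨n, mem_conductor.2 (Submodule.mem_one.2 ⟨d * a, ?_⟩)⟩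
        rw [map_mul, map_pow, hd]
        ring)
  refine dual_coeSubmodule_eq_one_iff.1 hId _ fun b hb => ?_
  obtain ⟨r, hr⟩ := Submodule.mem_one.1 (mem_conductor.1 (hIC hb))
  exact ⟨r, by rw [hr, mul_comm]⟩

/-- A `t`-linked overring of a PVMD that is not contained in the localization at `P` contains the
Kaplansky transform of `P`. -/
theorem IsPVMD.kaplanskyTransform_le [IsDomain R] [IsFractionRing R K]
    (hR : IsPVMD R K) {P : Ideal R} {T : Subalgebra R K} (hT : IsTLinked T)
    {x : K} (hxT : x ∈ T)
    (hx : ∀ s : R, (∃ r : R, algebraMap R K r = algebraMap R K s * x) → s ∈ P) :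
    kaplanskyTransform K P ≤ T := by
  intro u hu
  obtain ⟨p, q, hq, rfl⟩ := IsFractionRing.div_surjective (A := R) x
  have hq0 : q ≠ 0 := nonZeroDivisors.ne_zero hq
  have hqK : algebraMap R K q ≠ 0 := by
    simpa using hq0
  -- Take `A = (q, p)` with `x = p / q`. For `h ∈ A⁻¹`, `r = h q` is a denominator of `x`, hence in
  -- `P`, and `c = h p = r x` gives `u cⁿ = (u rⁿ) xⁿ ∈ T`.
  obtain ⟨I, hI0, hI, hIC, hId⟩ := hR.exists_fg_le_dual_eq_one hq0 (b := p)
    (conductor (Subalgebra.toSubmodule T) u) (by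
      intro h r c hr hc
      have hrc : algebraMap R K c = algebraMap R K r * (algebraMap R K p / algebraMap R K q) := by
        rw [hc, hr]
        field_simp
      obtain ⟨n, -, d, hd⟩ := hu r (hx r ⟨c, hrc⟩)
      have hdT : algebraMap R K d ∈ T := T.algebraMap_mem d
      refine ⟨⟨n, mem_conductor.2 ?_⟩, ⟨n, mem_conductor.2 ?_⟩⟩
      · rw [map_pow, mul_comm, ← hd]
        exact hdT
      · rw [map_pow, hrc, mul_pow, mul_comm, ← mul_assoc, ← hd]
        exact T.mul_mem hdT (T.pow_mem hxT n))
  exact hT.mem_of_le_conductor hI0 hI hId hIC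

end PVMD

theorem theorem3p2 {R : Type*} [CommRing R] [IsDomain R] {K : Type*} [Field K] [Algebra R K]
    [IsFractionRing R K] (hR : PVMD.IsPVMD R K) (P : Ideal R) (hP : P.IsPrime) (hP0 : P ≠ ⊥)
    (hPt : PVMD.IsTIdeal (IsLocalization.coeSubmodule K P))
    (hPinv : ¬ PVMD.IsTInvertible (IsLocalization.coeSubmodule K P)) :
    ¬ ∃ T : Subalgebra R K, PVMD.IsTLinked T ∧
      PVMD.dual (IsLocalization.coeSubmodule K P) < Subalgebra.toSubmodule T ∧
      T < PVMD.kaplanskyTransform K P := by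
  rintro ⟨T, hT, hPT, hTP⟩
  -- All denominators of `x` lie in `P`, that is, `x ∉ R_P`.
  by_cases h : ∃ x ∈ T, ∀ s : R, (∃ r : R, algebraMap R K r = algebraMap R K s * x) → s ∈ P
  · obtain ⟨x, hxT, hx⟩ := h
    exact hTP.not_ge (hR.kaplanskyTransform_le hT hxT hx)
  · refine hPT.not_ge fun u hu => ?_
    push Not at h
    obtain ⟨s, hsu, hs⟩ := h u hu
    exact hR.mem_dual_of_mem_kaplanskyTransform hP (hTP.le hu) hs hsu
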